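/- Let $n\ge 1$, let $C_2=\{0,1\}$ (written additively), $C_n=\mathbb{Z}/n\mathbb{Z}$, and let $C_2^n$ be the group of all maps $\theta:C_n\to C_2$, on which $C_n$ acts by $(k\theta)(j)=\theta(j-k)$. The wreath product $C_2\wr C_n$ is the set of pairs $(\theta,k)$, $\theta\in C_2^n$, $k\in C_n$, with the product $(\theta,k)(\omega,h)=(\theta+k\omega,\,k+h)$. For $\theta\in C_2^n$, regarded as an $n$-periodic function on $\mathbb{Z}$, let $t(\theta)$ be its period, i.e. the smallest positive integer $t$ with $\theta(k+t)=\theta(k)$ for all $k\in\mathbb{Z}$. It divides $n$; put $m(\theta)=n/t(\theta)$, let $\langle t(\theta)\rangle$ be the subgroup of $C_n$ generated by $t(\theta)$, and let $C_2\wr\langle t(\theta)\rangle=\{(\omega,k):\omega\in C_2^n,\ k\in\langle t(\theta)\rangle\}\le C_2\wr C_n$. Put $\chi_\theta(\omega)=(-1)^{\sum_{x\in C_n}\theta(x)\omega(x)}$ for $\omega\in C_2^n$, and $e_r(h)=\exp(2\pi i\,hr/n)$ for $h\in C_n$. Let $\tilde\chi_\theta(\omega,k)=\chi_\theta(\omega)$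 be the extension of $\chi_\theta$, and $(e_r|_{\langle t(\theta)\rangle})^\#(\omega,k)=e_r(k)$ the inflation of $e_r|_{\langle t(\theta)\rangle}$, both to $C_2\wr\langle t(\theta)\rangle$, so that $\tilde\chi_\theta\otimes(e_r|_{\langle t(\theta)\rangle})^\#$ is the one-dimensional complex representation $(\omega,k)\mapsto\chi_\theta(\omega)e_r(k)$ of $C_2\wr\langle t(\theta)\rangle$. **Theorem.** Let $\Theta\subseteq C_2^n$ contain exactly one element of each orbit of $C_n$ on $C_2^n$. Then the induced representations $$\mathrm{Ind}_{C_2\wr\langle t(\theta)\rangle}^{C_2\wr C_n}\left[\tilde\chi_\theta\otimes(e_r|_{\langle t(\theta)\rangle})^\#\right],\qquad \theta\in\Theta,\quad r=0,1,\dots,m(\theta)-1,$$ form a complete list of inequivalent irreducible complex representations of $C_2\wr C_n$: each of them is irreducible, those with distinct indices $(\theta,r)$ are inequivalent, and every irreducible complex representation of $C_2\wr C_n$ is equivalent to one of them. -/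

import Mathlib

open scoped BigOperators

namespace LamplighterCircle

section Defs

/-- The action of the additive group `ZMod n` on configurations `θ : ZMod n → ZMod 2`
by translation: `(k θ)(j) = θ (j - k)`. -/
def rotate {n : ℕ} (k : ZMod n) (θ : ZMod n → ZMod 2) : ZMod n → ZMod 2 :=
  fun j => θ (j - k)

/-- The translation action as a homomorphism into the automorphism group of `C₂ⁿ`
(groups written multiplicatively, as `SemidirectProduct` requires). -/
def rotateHom (n : ℕ) :
    Multiplicative (ZMod n) →* MulAut (Multiplicative (ZMod n → ZMod 2)) where
  toFun k :=
    { toFun := fun ω => Multiplicative.ofAdd (rotate k.toAdd ω.toAdd)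
      invFun := fun ω => Multiplicative.ofAdd (rotate (-k.toAdd) ω.toAdd)
      left_inv := fun ω => Multiplicative.toAdd.injective (by funext j; simp [rotate])
      right_inv := fun ω => Multiplicative.toAdd.injective (by funext j; simp [rotate])
      map_mul' := fun _ _ => rfl }
  map_one' := by
    ext ω : 1
    exact Multiplicative.toAdd.injective (by funext j; simp [rotate])
  map_mul' k h := by
    ext ω : 1
    exact Multiplicative.toAdd.injective (by
      funext j
      change ω.toAdd (j - (k.toAdd + h.toAdd)) = ω.toAdd (j - k.toAdd - h.toAdd)
      rw [sub_sub])

/-- The wreath product `C₂ ≀ Cₙ`: pairs `(θ, k)` with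
`(θ, k) (ω, h) = (θ + k ω, k + h)`. -/
abbrev Wreath (n : ℕ) : Type :=
  Multiplicative (ZMod n → ZMod 2) ⋊[rotateHom n] Multiplicative (ZMod n)

/-- The period of `θ`, regarded as an `n`-periodic function on `ℤ`: the smallest positive
integer `t` with `θ (k + t) = θ k` for all integers `k`. -/
noncomputable def period {n : ℕ} (θ : ZMod n → ZMod 2) : ℕ :=
  sInf {t : ℕ | 0 < t ∧ ∀ k : ℤ, θ ((k + (t : ℤ) : ℤ) : ZMod n) = θ (k : ZMod n)}

theorem period_spec {n : ℕ} [NeZero n] (θ : ZMod n → ZMod 2) :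
    0 < period θ ∧
      ∀ k : ℤ, θ ((k + (period θ : ℤ) : ℤ) : ZMod n) = θ (k : ZMod n) :=
  Nat.sInf_mem (s := {t : ℕ | 0 < t ∧
      ∀ k : ℤ, θ ((k + (t : ℤ) : ℤ) : ZMod n) = θ (k : ZMod n)})
    ⟨n, Nat.pos_of_ne_zero (NeZero.ne n), fun k => by simp⟩

/-- The period divides `n`, so that the quotient `n / period θ` is exact. -/
theorem period_dvd {n : ℕ} [NeZero n] (θ : ZMod n → ZMod 2) : period θ ∣ n := by
  obtain ⟨hpos, hper⟩ := period_spec θ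
  have hmul : ∀ (q : ℕ) (k : ℤ),
      θ ((k + (period θ : ℤ) * q : ℤ) : ZMod n) = θ (k : ZMod n) := by
    intro q
    induction q with
    | zero => simp
    | succ q ih =>
      intro k
      rw [← ih k, ← hper (k + (period θ : ℤ) * q)]
      congr 2
      push_cast
      ring
  by_contra hnd
  have hmod : 0 < n % period θ :=
    Nat.pos_of_ne_zero fun h => hnd (Nat.dvd_of_mod_eq_zero h)
  have hle : period θ ≤ n % period θ := by
    refine Nat.sInf_le ⟨hmod, fun k => ?_⟩
    rw [← hmul (n / period θ)]
    have e : k + ((n % period θ : ℕ) : ℤ) + (period θ : ℤ) * ((n / period θ : ℕ) : ℤ)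
        = k + (n : ℤ) := by
      have h := Nat.mod_add_div n (period θ)
      zify at h
      push_cast
      linarith
    rw [e]
    simp
  exact absurd (Nat.mod_lt n hpos) (not_lt.mpr hle)

/-- The subgroup `⟨t(θ)⟩` of `Cₙ`. -/
noncomputable def periodSubgroup {n : ℕ} (θ : ZMod n → ZMod 2) :
    Subgroup (Multiplicative (ZMod n)) :=
  Subgroup.zpowers (Multiplicative.ofAdd ((period θ : ℕ) : ZMod n))

/-- The subgroup `C₂ ≀ ⟨t(θ)⟩ = {(ω, k) : k ∈ ⟨t(θ)⟩}` of `C₂ ≀ Cₙ`. -/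
noncomputable def wreathSubgroup {n : ℕ} (θ : ZMod n → ZMod 2) : Subgroup (Wreath n) :=
  (periodSubgroup θ).comap SemidirectProduct.rightHom

theorem apply_add_of_mem {n : ℕ} [NeZero n] (θ : ZMod n → ZMod 2)
    {k : Multiplicative (ZMod n)} (hk : k ∈ periodSubgroup θ) (j : ZMod n) :
    θ (j + k.toAdd) = θ j := by
  have h1 : ∀ j : ZMod n, θ (j + (period θ : ZMod n)) = θ j := by
    intro j
    have := (period_spec θ).2 (j.val : ℤ)
    simpa using this
  obtain ⟨z, rfl⟩ := hk
  simp only [toAdd_zpow, toAdd_ofAdd]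
  induction z using Int.induction_on generalizing j with
  | zero => simp
  | succ i ih => rw [add_smul, one_smul, ← add_assoc, h1, ih]
  | pred i ih =>
    rw [sub_smul, one_smul, ← h1, add_assoc, sub_add_cancel, ih]

/-- The character `χ_θ(ω) = (-1)^{θ·ω}` of `C₂ⁿ`, where `θ·ω = ∑ₓ θ(x) ω(x)`. -/
noncomputable def lampChar {n : ℕ} [NeZero n] (θ : ZMod n → ZMod 2) :
    Multiplicative (ZMod n → ZMod 2) →* ℂ where
  toFun ω := (-1 : ℂ) ^ (∑ x, θ x * ω.toAdd x : ZMod 2).val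
  map_one' := by simp
  map_mul' a b := by
    rw [← pow_add]
    simp only [toAdd_mul, Pi.add_apply, mul_add, Finset.sum_add_distrib, ZMod.val_add]
    rw [neg_one_pow_eq_pow_mod_two (n := _ + _)]

theorem lampChar_rotate {n : ℕ} [NeZero n] (θ : ZMod n → ZMod 2)
    {k : Multiplicative (ZMod n)} (hk : k ∈ periodSubgroup θ)
    (ω : Multiplicative (ZMod n → ZMod 2)) :
    lampChar θ (rotateHom n k ω) = lampChar θ ω := by
  have h : (∑ x, θ x * rotate k.toAdd ω.toAdd x) = ∑ x, θ x * ω.toAdd x := by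
    rw [← Equiv.sum_comp (Equiv.addRight k.toAdd)]
    exact Finset.sum_congr rfl fun x _ => by
      simp [rotate, apply_add_of_mem θ hk]
  exact congrArg (fun a : ZMod 2 => (-1 : ℂ) ^ a.val) h

/-- The extension `χ̃_θ(ω, k) = χ_θ(ω)` of `χ_θ` to a character of `C₂ ≀ ⟨t(θ)⟩`. -/
noncomputable def extChar {n : ℕ} [NeZero n] (θ : ZMod n → ZMod 2) :
    wreathSubgroup θ →* ℂ where
  toFun g := lampChar θ g.1.left
  map_one' := by simp
  map_mul' a b := by
    have ha : a.1.right ∈ periodSubgroup θ := a.2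
    simp [lampChar_rotate θ ha]

/-- The inflation `η^#(ω, k) = η(k)` to `C₂ ≀ ⟨t(θ)⟩` of a character `η` of `⟨t(θ)⟩`. -/
noncomputable def inflate {n : ℕ} (θ : ZMod n → ZMod 2) (η : periodSubgroup θ →* ℂ) :
    wreathSubgroup θ →* ℂ :=
  η.comp (SemidirectProduct.rightHom.subgroupComap (periodSubgroup θ))

/-- The character `e_r(h) = exp(2π i h r / n)` of `Cₙ`. -/
noncomputable def cycChar (n : ℕ) [NeZero n] (r : ℕ) : Multiplicative (ZMod n) →* ℂ where
  toFun h := Complex.exp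
    (2 * Real.pi * Complex.I * ((h.toAdd.val : ℂ) * (r : ℂ) / (n : ℂ)))
  map_one' := by simp
  map_mul' a b := by
    have key : ∀ h : ZMod n,
        Complex.exp (2 * Real.pi * Complex.I * ((h.val : ℂ) * (r : ℂ) / (n : ℂ)))
          = ZMod.stdAddChar h ^ r := by
      intro h
      have hh : ((h.val : ℤ) : ZMod n) = h := by simp
      conv_rhs => rw [← hh, ZMod.stdAddChar_coe, ← Complex.exp_nat_mul]
      congr 1
      push_cast
      ring
    rw [key, key, key, toAdd_mul, AddChar.map_add_eq_mul, mul_pow]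

/-- The one-dimensional complex representation afforded by a linear character `χ`:
`g` acts on `ℂ` as multiplication by `χ g`. -/
noncomputable def charRep {G : Type*} [Group G] (χ : G →* ℂ) : Representation ℂ G ℂ :=
  (Algebra.lmul ℂ ℂ : ℂ →* Module.End ℂ ℂ).comp χ

/-- The one-dimensional representation `χ̃_θ ⊗ (e_r|_{⟨t(θ)⟩})^#` of `C₂ ≀ ⟨t(θ)⟩`;
the tensor product of linear characters is their pointwise product. -/
noncomputable def lampRep {n : ℕ} [NeZero n] (θ : ZMod n → ZMod 2) (r : ℕ) :
    Representation ℂ (wreathSubgroup θ) ℂ :=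
  charRep (extChar θ * inflate θ ((cycChar n r).comp (periodSubgroup θ).subtype))

/-- The representation of `C₂ ≀ Cₙ` induced from `χ̃_θ ⊗ (e_r|_{⟨t(θ)⟩})^#`. -/
noncomputable abbrev indRep {n : ℕ} [NeZero n] (θ : ZMod n → ZMod 2) (r : ℕ) :
    Representation ℂ (Wreath n)
      (Representation.IndV (wreathSubgroup θ).subtype (lampRep θ r)) :=
  Representation.ind (wreathSubgroup θ).subtype (lampRep θ r)

/-- `Θ` contains exactly one element of each orbit of `Cₙ` on `C₂ⁿ`. -/
def IsOrbitTransversal {n : ℕ} (Θ : Set (ZMod n → ZMod 2)) : Prop :=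
  ∀ ω : ZMod n → ZMod 2, ∃! θ, θ ∈ Θ ∧ ∃ k : ZMod n, rotate k ω = θ

end Defs

end LamplighterCircle

namespace LamplighterCircle

variable {n : ℕ} [NeZero n] {V : Type*} [AddCommGroup V] [Module ℂ V]

/-! Everything rests on weight vectors: vectors on which C₂ ≀ ⟨t(θ)⟩ acts by the inducing character.
Any nonzero representation contains one with index in the list (`exists_isWeightVector`): project to
a χ_θ-eigenspace, translate θ into Θ, and diagonalise t(θ), whose m(θ)-th power is trivial. By
Frobenius reciprocity a weight vector is the image of the generator of the induced representation.
Since ⟨t(θ)⟩ is the full stabiliser of θ, the χ_θ-eigenspace of that representation is the line of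
the generator, so its nonzero weight vectors have one index and are multiples of the generator
(`IsWeightVector.eq_of_indRep`). Irreducibility and inequivalence follow; Schur's lemma gives
completeness. No dimension count is used, and V may have any dimension a priori. -/

/-! ### Characters of C₂ⁿ and their orthogonality. -/

theorem lampChar_apply (θ : ZMod n → ZMod 2) (ω : Multiplicative (ZMod n → ZMod 2)) :
    lampChar θ ω = (-1 : ℂ) ^ (∑ x, θ x * ω.toAdd x : ZMod 2).val := rfl

/-- Symmetry of θ·ω; it transfers multiplicativity and orthogonality from ω to θ. -/
theorem lampChar_comm (θ ω : ZMod n → ZMod 2) :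
    lampChar θ (Multiplicative.ofAdd ω) = lampChar ω (Multiplicative.ofAdd θ) := by
  simp only [lampChar_apply, toAdd_ofAdd, mul_comm]

theorem lampChar_add (θ θ' : ZMod n → ZMod 2) (ω : Multiplicative (ZMod n → ZMod 2)) :
    lampChar (θ + θ') ω = lampChar θ ω * lampChar θ' ω := by
  have h := map_mul (lampChar ω.toAdd) (Multiplicative.ofAdd θ) (Multiplicative.ofAdd θ')
  rw [← ofAdd_add] at h
  simpa only [lampChar_comm ω.toAdd, ofAdd_toAdd] using h

theorem lampChar_mul_self (θ : ZMod n → ZMod 2) (ω : Multiplicative (ZMod n → ZMod 2)) :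
    lampChar θ ω * lampChar θ ω = 1 := by
  rw [lampChar_apply, ← mul_pow]; simp

theorem lampChar_ne_one {θ : ZMod n → ZMod 2} (h : θ ≠ 0) : lampChar θ ≠ 1 := by
  intro h1
  obtain ⟨x, hx⟩ := Function.ne_iff.1 h
  have hx1 : θ x = 1 := by
    have : ∀ a : ZMod 2, a ≠ 0 → a = 1 := by decide
    exact this _ hx
  have h2 := DFunLike.congr_fun h1 (Multiplicative.ofAdd (Pi.single x 1))
  rw [lampChar_apply, toAdd_ofAdd, Finset.sum_eq_single x (fun y _ hy => by simp [hy])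
    (by simp), hx1, Pi.single_eq_same, mul_one, MonoidHom.one_apply, ZMod.val_one] at h2
  norm_num at h2

theorem sum_lampChar {θ : ZMod n → ZMod 2} (h : θ ≠ 0) : ∑ ω, lampChar θ ω = 0 :=
  sum_hom_units_eq_zero _ (lampChar_ne_one h)

theorem sum_lampChar_left {ω : Multiplicative (ZMod n → ZMod 2)} (h : ω ≠ 1) :
    ∑ θ, lampChar θ ω = 0 := by
  rw [← sum_lampChar (θ := ω.toAdd) (by simpa using h)]
  exact Fintype.sum_equiv Multiplicative.ofAdd _ _ fun θ => lampChar_comm θ ω.toAdd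

theorem lampChar_rotateHom (θ : ZMod n → ZMod 2) (k : Multiplicative (ZMod n))
    (ω : Multiplicative (ZMod n → ZMod 2)) :
    lampChar θ (rotateHom n k ω) = lampChar (rotate (-k.toAdd) θ) ω := by
  have h : (∑ x, θ x * rotate k.toAdd ω.toAdd x)
      = ∑ x, rotate (-k.toAdd) θ x * ω.toAdd x := by
    rw [← Equiv.sum_comp (Equiv.addRight k.toAdd)]
    exact Finset.sum_congr rfl fun x _ => by simp [rotate]
  exact congrArg (fun a : ZMod 2 => (-1 : ℂ) ^ a.val) h

/-! ### Stabilisers of configurations and characters of Cₙ. -/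

theorem rotate_zero {n : ℕ} (θ : ZMod n → ZMod 2) : rotate 0 θ = θ := by
  funext j; simp [rotate]

/-- Divide k by the period: a nonzero remainder would be a smaller period. -/
theorem mem_periodSubgroup_of_rotate_eq {θ : ZMod n → ZMod 2} {k : Multiplicative (ZMod n)}
    (h : rotate (-k.toAdd) θ = θ) : k ∈ periodSubgroup θ := by
  have hk : ∀ j, θ (j + k.toAdd) = θ j := fun j => by simpa [rotate] using congrFun h j
  obtain ⟨hpos, -⟩ := period_spec θ
  have key : (((k.toAdd.val % period θ : ℕ) : ZMod n)) + ((k.toAdd.val / period θ : ℕ) : ZMod n)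
      * (period θ : ZMod n) = k.toAdd := by
    rw [← Nat.cast_mul, ← Nat.cast_add, mul_comm, Nat.mod_add_div, ZMod.natCast_zmod_val]
  have hmem : Multiplicative.ofAdd (((k.toAdd.val / period θ : ℕ) : ZMod n)
      * (period θ : ZMod n)) ∈ periodSubgroup θ :=
    ⟨((k.toAdd.val / period θ : ℕ) : ℤ), Multiplicative.toAdd.injective (by
      simp only [toAdd_zpow, toAdd_ofAdd, zsmul_eq_mul, Int.cast_natCast])⟩
  rcases Nat.eq_zero_or_pos (k.toAdd.val % period θ) with h0 | h0
  · rw [h0, Nat.cast_zero, zero_add] at key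
    rwa [key] at hmem
  · have hle : period θ ≤ k.toAdd.val % period θ := by
      refine Nat.sInf_le ⟨h0, fun z => ?_⟩
      rw [← apply_add_of_mem θ hmem, toAdd_ofAdd]
      rw [Int.cast_add, Int.cast_natCast, add_assoc, key, hk]
    exact absurd (Nat.mod_lt _ hpos) (not_lt.mpr hle)

theorem cycChar_apply (r : ℕ) (h : Multiplicative (ZMod n)) :
    cycChar n r h = ZMod.stdAddChar h.toAdd ^ r := by
  have hh : ((h.toAdd.val : ℤ) : ZMod n) = h.toAdd := by simp
  conv_rhs => rw [← hh, ZMod.stdAddChar_coe, ← Complex.exp_nat_mul]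
  refine congrArg Complex.exp ?_
  push_cast
  ring

/-- Primitivity makes the values e_r(t(θ)), r < m(θ), distinct and exhausts the m(θ)-th roots of
unity. -/
theorem isPrimitiveRoot_stdAddChar_period (θ : ZMod n → ZMod 2) :
    IsPrimitiveRoot (ZMod.stdAddChar (period θ : ZMod n)) (n / period θ) := by
  obtain ⟨hpos, -⟩ := period_spec θ
  obtain ⟨m, hm⟩ := period_dvd θ
  have hn : n ≠ 0 := NeZero.ne n
  have hm0 : m ≠ 0 := by rintro rfl; simp at hm; exact hn hm
  have hdiv : n / period θ = m := Nat.div_eq_of_eq_mul_right hpos hm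
  rw [hdiv]
  convert Complex.isPrimitiveRoot_exp m hm0 using 1
  have := ZMod.stdAddChar_coe (N := n) (period θ : ℤ)
  rw [Int.cast_natCast] at this
  rw [this]
  congr 1
  have hnc : (n : ℂ) = period θ * m := by rw [← Nat.cast_mul, ← hm]
  have h1 : (m : ℂ) ≠ 0 := Nat.cast_ne_zero.2 hm0
  have h2 : (period θ : ℂ) ≠ 0 := Nat.cast_ne_zero.2 hpos.ne'
  rw [hnc]
  push_cast
  field_simp

/-! ### Eigenvectors and the eigenspaces of C₂ⁿ. -/

/-- If a product of factors `T - c` kills a nonzero vector of a `T`-stable subspace, then some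
`c` is an eigenvalue of `T` on that subspace. -/
theorem exists_eigenvector_of_aeval_prod_eq_zero (T : Module.End ℂ V) (W : Submodule ℂ V)
    (hW : ∀ v ∈ W, T v ∈ W) (s : Finset ℂ) : ∀ v ∈ W, v ≠ 0 →
      Polynomial.aeval T (∏ c ∈ s, (Polynomial.X - Polynomial.C c)) v = 0 →
        ∃ c ∈ s, ∃ u ∈ W, u ≠ 0 ∧ T u = c • u := by
  induction s using Finset.induction_on with
  | empty => intro v _ h0 h; simp at h; exact absurd h h0
  | insert a s ha ih =>
    intro v hv h0 h
    -- Commuting the factors makes T - a act first: either it kills v, or its value replaces v.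
    rw [Finset.prod_insert ha, mul_comm, map_mul, Module.End.mul_apply] at h
    by_cases h1 : Polynomial.aeval T (Polynomial.X - Polynomial.C a) v = 0
    · refine ⟨a, Finset.mem_insert_self _ _, v, hv, h0, ?_⟩
      simpa [sub_eq_zero] using h1
    · have hmem : Polynomial.aeval T (Polynomial.X - Polynomial.C a) v ∈ W := by
        simpa using W.sub_mem (hW v hv) (W.smul_mem a hv)
      obtain ⟨c, hc, u, hu⟩ := ih _ hmem h1 h
      exact ⟨c, Finset.mem_insert_of_mem hc, u, hu⟩

/-- The `χ_θ`-eigenspace of `C₂ⁿ` in a representation of `C₂ ≀ Cₙ`. -/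
def lampSpace (ρ : Representation ℂ (Wreath n) V) (θ : ZMod n → ZMod 2) : Submodule ℂ V where
  carrier := {v | ∀ ω, ρ (SemidirectProduct.inl ω) v = lampChar θ ω • v}
  add_mem' ha hb ω := by rw [map_add, ha ω, hb ω, smul_add]
  zero_mem' ω := by simp
  smul_mem' c v hv ω := by rw [map_smul, hv ω, smul_comm]

/-- The unnormalised projection `∑ χ_θ(ω) ω` onto the `χ_θ`-eigenspace. -/
noncomputable def lampProj (ρ : Representation ℂ (Wreath n) V) (θ : ZMod n → ZMod 2) :
    Module.End ℂ V :=
  ∑ ω, lampChar θ ω • ρ (SemidirectProduct.inl ω)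

variable {ρ : Representation ℂ (Wreath n) V}

theorem lampProj_apply (θ : ZMod n → ZMod 2) (v : V) :
    lampProj ρ θ v = ∑ ω, lampChar θ ω • ρ (SemidirectProduct.inl ω) v := by
  simp [lampProj]

theorem lampProj_mem (θ : ZMod n → ZMod 2) (v : V) : lampProj ρ θ v ∈ lampSpace ρ θ := by
  intro ω
  rw [lampProj_apply, map_sum, Finset.smul_sum]
  refine Fintype.sum_equiv (Equiv.mulLeft ω) _ _ fun a => ?_
  rw [Equiv.coe_mulLeft, map_smul, map_mul, map_mul, map_mul, Module.End.mul_apply, smul_smul,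
    ← mul_assoc, lampChar_mul_self, one_mul]

/-- Summing χ_θ(ω) over θ leaves only ω = 1; hence some projection of a nonzero vector is nonzero.
-/
theorem sum_lampProj (v : V) :
    ∑ θ, lampProj ρ θ v = (Fintype.card (ZMod n → ZMod 2) : ℂ) • v := by
  simp only [lampProj_apply]
  rw [Finset.sum_comm, Finset.sum_eq_single 1]
  · simp only [map_one, one_smul, Module.End.one_apply, Finset.sum_const, Finset.card_univ,
      Nat.cast_smul_eq_nsmul]
  · intro ω _ hω
    rw [← Finset.sum_smul, sum_lampChar_left hω, zero_smul]
  · simp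

theorem exists_lampProj_ne_zero {v : V} (hv : v ≠ 0) : ∃ θ, lampProj ρ θ v ≠ 0 := by
  by_contra! h
  have := sum_lampProj (ρ := ρ) v
  simp only [h, Finset.sum_const_zero] at this
  exact smul_ne_zero (Nat.cast_ne_zero.2 Fintype.card_ne_zero) hv this.symm

theorem lampProj_of_mem {θ : ZMod n → ZMod 2} {v : V} (hv : v ∈ lampSpace ρ θ) :
    lampProj ρ θ v = (Fintype.card (Multiplicative (ZMod n → ZMod 2)) : ℂ) • v := by
  rw [lampProj_apply]
  simp only [hv _, smul_smul, lampChar_mul_self, one_smul, Finset.sum_const, Finset.card_univ]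
  rw [Nat.cast_smul_eq_nsmul]

theorem lampProj_of_mem_of_ne {θ θ' : ZMod n → ZMod 2} (h : θ' ≠ θ) {v : V}
    (hv : v ∈ lampSpace ρ θ) : lampProj ρ θ' v = 0 := by
  rw [lampProj_apply]
  simp only [hv _, smul_smul, ← lampChar_add]
  rw [← Finset.sum_smul, sum_lampChar, zero_smul]
  intro h0
  refine h (funext fun x => ?_)
  have h2 : ∀ a b : ZMod 2, a + b = 0 → a = b := by decide
  exact h2 _ _ (congrFun h0 x)

theorem inr_mem_lampSpace {θ : ZMod n → ZMod 2} {v : V} (hv : v ∈ lampSpace ρ θ)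
    (k : Multiplicative (ZMod n)) :
    ρ (SemidirectProduct.inr k) v ∈ lampSpace ρ (rotate k.toAdd θ) := by
  intro ω
  have h : (SemidirectProduct.inl ω * SemidirectProduct.inr k : Wreath n)
      = SemidirectProduct.inr k * SemidirectProduct.inl (rotateHom n k⁻¹ ω) := by
    ext <;> simp
  rw [← Module.End.mul_apply, ← map_mul, h, map_mul, Module.End.mul_apply, hv, map_smul,
    lampChar_rotateHom, toAdd_inv, neg_neg]

/-! ### Weight vectors and their existence. -/

/-- The linear character `χ̃_θ ⊗ (e_r|_{⟨t(θ)⟩})^#`. -/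
noncomputable def lampLinChar (θ : ZMod n → ZMod 2) (r : ℕ) : wreathSubgroup θ →* ℂ :=
  extChar θ * inflate θ ((cycChar n r).comp (periodSubgroup θ).subtype)

theorem lampLinChar_apply (θ : ZMod n → ZMod 2) (r : ℕ) (g : wreathSubgroup θ) :
    lampLinChar θ r g = lampChar θ g.1.left * cycChar n r g.1.right := rfl

theorem lampRep_apply (θ : ZMod n → ZMod 2) (r : ℕ) (g : wreathSubgroup θ) (a : ℂ) :
    lampRep θ r g a = lampLinChar θ r g * a := rfl

theorem lampLinChar_ne_zero (θ : ZMod n → ZMod 2) (r : ℕ) (g : wreathSubgroup θ) :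
    lampLinChar θ r g ≠ 0 :=
  ((Group.isUnit g).map (lampLinChar θ r)).ne_zero

/-- `v` spans a copy of `χ̃_θ ⊗ (e_r|_{⟨t(θ)⟩})^#` in the restriction of `ρ`, or is zero. -/
def IsWeightVector (ρ : Representation ℂ (Wreath n) V) (θ : ZMod n → ZMod 2) (r : ℕ) (v : V) :
    Prop :=
  ∀ g : wreathSubgroup θ, ρ g v = lampLinChar θ r g • v

theorem IsWeightVector.mem_lampSpace {θ : ZMod n → ZMod 2} {r : ℕ} {v : V}
    (hv : IsWeightVector ρ θ r v) : v ∈ lampSpace ρ θ := by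
  intro ω
  have := hv ⟨SemidirectProduct.inl ω, by simp [wreathSubgroup]⟩
  rw [lampLinChar_apply] at this
  simpa using this

theorem ofAdd_period_mem {n : ℕ} (θ : ZMod n → ZMod 2) :
    Multiplicative.ofAdd (period θ : ZMod n) ∈ periodSubgroup θ :=
  Subgroup.mem_zpowers _

theorem IsWeightVector.inr_period {θ : ZMod n → ZMod 2} {r : ℕ} {v : V}
    (hv : IsWeightVector ρ θ r v) :
    ρ (SemidirectProduct.inr (Multiplicative.ofAdd (period θ : ZMod n))) v
      = ZMod.stdAddChar (period θ : ZMod n) ^ r • v := by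
  have := hv ⟨SemidirectProduct.inr (Multiplicative.ofAdd (period θ : ZMod n)), by
    simpa [wreathSubgroup] using ofAdd_period_mem θ⟩
  rw [lampLinChar_apply, cycChar_apply] at this
  simpa using this

/-- C₂ⁿ and t(θ) generate the subgroup; by finiteness natural powers of t(θ) suffice. -/
theorem isWeightVector_of_inr_period {θ : ZMod n → ZMod 2} {r : ℕ} {v : V}
    (hv : v ∈ lampSpace ρ θ)
    (ht : ρ (SemidirectProduct.inr (Multiplicative.ofAdd (period θ : ZMod n))) v
      = ZMod.stdAddChar (period θ : ZMod n) ^ r • v) : IsWeightVector ρ θ r v := by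
  have hpow : ∀ j : ℕ, ρ (SemidirectProduct.inr (Multiplicative.ofAdd (period θ : ZMod n) ^ j)) v
      = cycChar n r (Multiplicative.ofAdd (period θ : ZMod n) ^ j) • v := by
    intro j
    induction j with
    | zero => simp
    | succ j ih =>
      rw [pow_succ, map_mul, map_mul, Module.End.mul_apply, ht, map_smul, ih, smul_smul, map_mul,
        cycChar_apply r (Multiplicative.ofAdd (period θ : ZMod n)), toAdd_ofAdd, mul_comm]
  rintro ⟨g, hg⟩
  obtain ⟨j, hj⟩ := mem_powers_iff_mem_zpowers.2 (show g.right ∈ Subgroup.zpowers _ from hg)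
  have hcyc : ρ (SemidirectProduct.inr g.right) v = cycChar n r g.right • v := by
    have := hpow j
    simp only at hj
    rwa [hj] at this
  rw [lampLinChar_apply]
  change ρ g v = (lampChar θ g.left * cycChar n r g.right) • v
  conv_lhs => rw [← SemidirectProduct.inl_left_mul_inr_right g]
  rw [map_mul, Module.End.mul_apply, hcyc, map_smul, hv, smul_smul, mul_comm]

theorem rotate_of_mem_periodSubgroup {θ : ZMod n → ZMod 2} {k : Multiplicative (ZMod n)}
    (hk : k ∈ periodSubgroup θ) : rotate k.toAdd θ = θ := by
  funext j
  have := apply_add_of_mem θ hk (j - k.toAdd)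
  rw [sub_add_cancel] at this
  exact this.symm

/-- Every nonzero representation contains a weight vector with index in the given list. -/
theorem exists_isWeightVector [Nontrivial V] (ρ : Representation ℂ (Wreath n) V)
    {Θ : Set (ZMod n → ZMod 2)} (hΘ : IsOrbitTransversal Θ) :
    ∃ θ ∈ Θ, ∃ r < n / period θ, ∃ v, v ≠ 0 ∧ IsWeightVector ρ θ r v := by
  obtain ⟨v, hv⟩ := exists_ne (0 : V)
  obtain ⟨ω, hω⟩ := exists_lampProj_ne_zero (ρ := ρ) hv
  obtain ⟨θ, ⟨hθ, k, hk⟩, -⟩ := hΘ ω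
  -- Translating by k moves the eigenvector from ω to its orbit representative θ.
  have hmem := inr_mem_lampSpace (lampProj_mem (ρ := ρ) ω v) (Multiplicative.ofAdd k)
  rw [toAdd_ofAdd, hk] at hmem
  set T := ρ (SemidirectProduct.inr (Multiplicative.ofAdd (period θ : ZMod n))) with hT
  have hprim := isPrimitiveRoot_stdAddChar_period θ
  have hmpos : 0 < n / period θ :=
    Nat.div_pos (Nat.le_of_dvd (NeZero.pos n) (period_dvd θ)) (period_spec θ).1
  have : NeZero (n / period θ) := ⟨hmpos.ne'⟩
  have hTpow : T ^ (n / period θ) = 1 := by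
    rw [hT, ← map_pow, ← map_pow, ← ofAdd_nsmul, nsmul_eq_mul, ← Nat.cast_mul,
      Nat.div_mul_cancel (period_dvd θ), ZMod.natCast_self, ofAdd_zero, map_one, map_one]
  -- T is annihilated by X^m - 1, which splits into factors X - c over the m-th roots of unity.
  obtain ⟨c, hc, u, hu, hu0, hTu⟩ := exists_eigenvector_of_aeval_prod_eq_zero T (lampSpace ρ θ)
    (fun v hv => by
      have := inr_mem_lampSpace hv (Multiplicative.ofAdd (period θ : ZMod n))
      rwa [rotate_of_mem_periodSubgroup (ofAdd_period_mem θ)] at this)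
    (Polynomial.nthRootsFinset (n / period θ) (1 : ℂ)) _ hmem
    (fun h0 => hω (by
      have := congrArg (ρ (SemidirectProduct.inr (Multiplicative.ofAdd k))⁻¹) h0
      rwa [← Module.End.mul_apply, ← map_mul, inv_mul_cancel, map_one, Module.End.one_apply,
        map_zero] at this))
    (by rw [← Polynomial.X_pow_sub_one_eq_prod hmpos hprim]; simp [hTpow])
  obtain ⟨r, hr, rfl⟩ := hprim.eq_pow_of_pow_eq_one
    ((Polynomial.mem_nthRootsFinset hmpos _).1 hc)
  exact ⟨θ, hθ, r, hr, u, hu0, isWeightVector_of_inr_period hu hTu⟩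

/-! ### The induced representations. -/

section Induced

variable (θ : ZMod n → ZMod 2) (r : ℕ)

/-- The canonical generator `1 ⊗ 1` of the induced representation. -/
noncomputable def indGen : Representation.IndV (wreathSubgroup θ).subtype (lampRep θ r) :=
  Representation.IndV.mk _ _ 1 1

variable {θ r}

/-- The defining relation of the coinvariants. -/
theorem indV_mk_mul (h : wreathSubgroup θ) (g : Wreath n) (a : ℂ) :
    Representation.IndV.mk (wreathSubgroup θ).subtype (lampRep θ r) (h * g) (lampRep θ r h a)
      = Representation.IndV.mk (wreathSubgroup θ).subtype (lampRep θ r) g a := by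
  have := Representation.Coinvariants.mk_self_apply
    (ρ := Representation.tprod ((Representation.leftRegular ℂ (Wreath n)).comp
      (wreathSubgroup θ).subtype) (lampRep θ r)) h
      (TensorProduct.tmul ℂ (MonoidAlgebra.single g 1) a)
  simpa using this

theorem isWeightVector_indGen : IsWeightVector (indRep θ r) θ r (indGen θ r) := by
  intro g
  rw [indGen, Representation.ind_mk, ← indV_mk_mul g, ← map_smul, lampRep_apply]
  simp

theorem indV_mk_eq (g : Wreath n) (a : ℂ) :
    Representation.IndV.mk (wreathSubgroup θ).subtype (lampRep θ r) g a
      = a • indRep θ r g⁻¹ (indGen θ r) := by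
  rw [indGen, Representation.ind_mk, ← map_smul]
  simp

theorem span_indGen :
    Submodule.span ℂ (Set.range fun g => indRep θ r g (indGen θ r)) = ⊤ := by
  rw [← Submodule.ker_mkQ (Submodule.span ℂ _), LinearMap.ker_eq_top]
  refine Representation.IndV.hom_ext _ _ fun g => LinearMap.ext fun a => ?_
  rw [LinearMap.comp_apply, indV_mk_eq, LinearMap.zero_comp, LinearMap.zero_apply,
    Submodule.mkQ_apply, Submodule.Quotient.mk_eq_zero]
  exact Submodule.smul_mem _ _ (Submodule.subset_span ⟨g⁻¹, rfl⟩)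

/-- Linear maps out of the induced representation. -/
theorem exists_indV_lift {W : Type*} [AddCommGroup W] [Module ℂ W] (f : Wreath n → W)
    (hf : ∀ (h : wreathSubgroup θ) g, lampLinChar θ r h • f (h * g) = f g) :
    ∃ F : Representation.IndV (wreathSubgroup θ).subtype (lampRep θ r) →ₗ[ℂ] W,
      ∀ g a, F (Representation.IndV.mk _ _ g a) = a • f g := by
  refine ⟨Representation.Coinvariants.lift _ (TensorProduct.lift
    ((Finsupp.lift (ℂ →ₗ[ℂ] W) ℂ _ fun g => LinearMap.toSpanSingleton ℂ W (f g)) ∘ₗ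
      (MonoidAlgebra.coeffLinearEquiv ℂ).toLinearMap)) fun h => ?_, fun g a => ?_⟩
  · ext g
    have := hf h g
    simpa [lampRep_apply] using this
  · simp

theorem indGen_ne_zero : indGen θ r ≠ 0 := by
  classical
  obtain ⟨F, hF⟩ := exists_indV_lift (θ := θ) (r := r)
    -- The inverse character, extended by zero, respects the coinvariant relation and gives a
    -- functional equal to 1 on the generator.
    (fun g => if h : g ∈ wreathSubgroup θ then (lampLinChar θ r ⟨g, h⟩)⁻¹ else 0) (by
      intro h g
      by_cases hg : g ∈ wreathSubgroup θ
      · have hhg : (h : Wreath n) * g ∈ wreathSubgroup θ := mul_mem h.2 hg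
        have hm : lampLinChar θ r ⟨h * g, hhg⟩ = lampLinChar θ r h * lampLinChar θ r ⟨g, hg⟩ :=
          map_mul _ h ⟨g, hg⟩
        have h0 := lampLinChar_ne_zero θ r h
        rw [dif_pos hhg, dif_pos hg, hm, smul_eq_mul, mul_inv, mul_inv_cancel_left₀ h0]
      · have hhg : (h : Wreath n) * g ∉ wreathSubgroup θ := fun H =>
          hg ((mul_mem_cancel_left h.2).1 H)
        rw [dif_neg hhg, dif_neg hg, smul_zero])
  intro h
  have h1 := hF 1 1
  rw [show Representation.IndV.mk _ _ 1 1 = indGen θ r from rfl, h, map_zero,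
    dif_pos (one_mem _)] at h1
  have h2 : lampLinChar θ r ⟨1, one_mem _⟩ = 1 := map_one (lampLinChar θ r)
  rw [h2] at h1
  simp at h1

/-- Frobenius reciprocity; the inverse in g ↦ ρ(g⁻¹)v matches `indV_mk_eq`. -/
theorem exists_intertwiningMap_of_isWeightVector {v : V} (hv : IsWeightVector ρ θ r v) :
    ∃ f : (indRep θ r).IntertwiningMap ρ, f (indGen θ r) = v := by
  obtain ⟨F, hF⟩ := exists_indV_lift (θ := θ) (r := r) (fun g => ρ g⁻¹ v) (by
    intro h g
    rw [mul_inv_rev, map_mul, Module.End.mul_apply]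
    have := hv h⁻¹
    rw [InvMemClass.coe_inv] at this
    rw [this, map_smul, smul_smul, ← map_mul, mul_inv_cancel, map_one, one_smul])
  refine ⟨⟨F, fun g => ?_⟩, ?_⟩
  · refine Representation.IndV.hom_ext _ _ fun h => LinearMap.ext fun a => ?_
    change F (indRep θ r g (Representation.IndV.mk _ _ h a))
      = ρ g (F (Representation.IndV.mk _ _ h a))
    rw [Representation.ind_mk, hF, hF]
    simp
  · change F (indGen θ r) = v
    rw [indGen, hF]; simp

/-- In the representation induced from `(θ, r)`, the `χ_θ'`-eigenspace of `C₂ⁿ` is spanned by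
the translates of the generator by those `k` with `k θ = θ'`. -/
theorem lampSpace_indRep_le (θ' : ZMod n → ZMod 2) :
    lampSpace (indRep θ r) θ' ≤ Submodule.span ℂ {x | ∃ k : Multiplicative (ZMod n),
      rotate k.toAdd θ = θ' ∧ x = indRep θ r (SemidirectProduct.inr k) (indGen θ r)} := by
  set S := Submodule.span ℂ {x | ∃ k : Multiplicative (ZMod n),
      rotate k.toAdd θ = θ' ∧ x = indRep θ r (SemidirectProduct.inr k) (indGen θ r)} with hS
  -- It suffices to project the spanning translates: on the eigenspace `lampProj` is a nonzero
  -- scalar.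
  have hproj : (⊤ : Submodule ℂ _) ≤ S.comap (lampProj (indRep θ r) θ') := by
    rw [← span_indGen, Submodule.span_le]
    rintro _ ⟨g, rfl⟩
    have hk := inr_mem_lampSpace (isWeightVector_indGen (θ := θ) (r := r)).mem_lampSpace g.right
    change lampProj (indRep θ r) θ' (indRep θ r g (indGen θ r)) ∈ S
    rw [← SemidirectProduct.inl_left_mul_inr_right g, map_mul, Module.End.mul_apply, hk, map_smul]
    refine S.smul_mem _ ?_
    by_cases h : rotate g.right.toAdd θ = θ'
    · rw [lampProj_of_mem (h ▸ hk)]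
      exact S.smul_mem _ (Submodule.subset_span ⟨_, h, rfl⟩)
    · rw [lampProj_of_mem_of_ne (Ne.symm h) hk]
      exact S.zero_mem
  intro u hu
  have h1 : lampProj (indRep θ r) θ' u ∈ S := hproj Submodule.mem_top
  rw [lampProj_of_mem hu] at h1
  exact (S.smul_mem_iff (Nat.cast_ne_zero.2 Fintype.card_ne_zero)).1 h1

/-- A k fixing θ lies in ⟨t(θ)⟩, so it only rescales the generator. -/
theorem lampSpace_indRep_self_le :
    lampSpace (indRep θ r) θ ≤ Submodule.span ℂ {indGen θ r} := by
  refine (lampSpace_indRep_le θ).trans (Submodule.span_le.2 ?_)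
  rintro _ ⟨k, hk, rfl⟩
  have hmem : k⁻¹ ∈ periodSubgroup θ := mem_periodSubgroup_of_rotate_eq (by simpa using hk)
  have := isWeightVector_indGen (θ := θ) (r := r) ⟨SemidirectProduct.inr k, by
    simpa [wreathSubgroup] using hmem⟩
  exact this ▸ Submodule.smul_mem _ _ (Submodule.mem_span_singleton_self _)

/-- A nonzero weight vector of an induced representation determines the index, and is a multiple
of the generator. -/
theorem IsWeightVector.eq_of_indRep {Θ : Set (ZMod n → ZMod 2)} (hΘ : IsOrbitTransversal Θ)
    (hθ : θ ∈ Θ) (hr : r < n / period θ) {θ' : ZMod n → ZMod 2} (hθ' : θ' ∈ Θ) {r' : ℕ}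
    (hr' : r' < n / period θ')
    {u : Representation.IndV (wreathSubgroup θ).subtype (lampRep θ r)}
    (hu : IsWeightVector (indRep θ r) θ' r' u) (hu0 : u ≠ 0) :
    θ = θ' ∧ r = r' ∧ ∃ c : ℂ, c • indGen θ r = u := by
  obtain rfl : θ = θ' := by
    by_contra hne
    refine hu0 ?_
    have h := lampSpace_indRep_le θ' hu.mem_lampSpace
    -- Distinct members of Θ lie in distinct orbits, so the spanning set is empty.
    rwa [show {x | ∃ k : Multiplicative (ZMod n), rotate k.toAdd θ = θ' ∧
      x = indRep θ r (SemidirectProduct.inr k) (indGen θ r)} = ∅ from ?_, Submodule.span_empty,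
      Submodule.mem_bot] at h
    refine Set.eq_empty_of_forall_notMem ?_
    rintro _ ⟨k, hk, -⟩
    exact hne ((hΘ θ).unique ⟨hθ, 0, rotate_zero θ⟩ ⟨hθ', k.toAdd, hk⟩)
  obtain ⟨c, rfl⟩ := Submodule.mem_span_singleton.1 (lampSpace_indRep_self_le hu.mem_lampSpace)
  refine ⟨rfl, ?_, c, rfl⟩
  -- Comparing the eigenvalues of t(θ) on u and on the generator gives r = r'.
  have h1 := hu.inr_period
  rw [map_smul, isWeightVector_indGen.inr_period, smul_comm] at h1
  exact (isPrimitiveRoot_stdAddChar_period θ).pow_inj hr hr' (smul_left_injective ℂ hu0 h1)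

/-- A nonzero subrepresentation has a weight vector, hence contains the generator. -/
theorem isIrreducible_indRep {Θ : Set (ZMod n → ZMod 2)} (hΘ : IsOrbitTransversal Θ)
    (hθ : θ ∈ Θ) (hr : r < n / period θ) : (indRep θ r).IsIrreducible := by
  have : Nontrivial (Subrepresentation (indRep θ r)) := by
    refine ⟨⊥, ⊤, fun h => ?_⟩
    have : indGen θ r ∈ (⊥ : Subrepresentation (indRep θ r)) := by rw [h]; trivial
    exact indGen_ne_zero this
  refine ⟨fun S => ?_⟩
  refine or_iff_not_imp_left.2 fun hS => top_le_iff.1 fun x _ => ?_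
  have : Nontrivial S.toSubmodule := by
    refine Submodule.nontrivial_iff_ne_bot.2 fun h => hS ?_
    exact Subrepresentation.toSubmodule_injective h
  obtain ⟨θ', hθ', r', hr', v, hv0, hv⟩ := exists_isWeightVector S.toRepresentation hΘ
  have hv' : IsWeightVector (indRep θ r) θ' r' (v : Representation.IndV _ _) :=
    fun g => congrArg Subtype.val (hv g)
  obtain ⟨-, -, c, hc⟩ := hv'.eq_of_indRep hΘ hθ hr hθ' hr' (by simpa using hv0)
  have hgen : indGen θ r ∈ S.toSubmodule := by
    refine (S.toSubmodule.smul_mem_iff (s := c) ?_).1 (hc ▸ v.2)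
    rintro rfl
    exact hv0 (Subtype.ext (by rw [← hc, zero_smul]; rfl))
  have hle : (⊤ : Submodule ℂ _) ≤ S.toSubmodule := by
    rw [← span_indGen, Submodule.span_le]
    rintro _ ⟨g, rfl⟩
    exact S.apply_mem_toSubmodule g hgen
  exact hle Submodule.mem_top

end Induced

/-! ### The classification. -/

theorem IsWeightVector.map {W : Type*} [AddCommGroup W] [Module ℂ W]
    {σ : Representation ℂ (Wreath n) W} {θ : ZMod n → ZMod 2} {r : ℕ} {v : V}
    (hv : IsWeightVector ρ θ r v) (f : ρ.IntertwiningMap σ) : IsWeightVector σ θ r (f v) := by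
  intro g
  rw [← f.isIntertwining, hv g, map_smul]

end LamplighterCircle

theorem mainTheorem9 (n : ℕ) [NeZero n] (Θ : Set (ZMod n → ZMod 2))
    (hΘ : LamplighterCircle.IsOrbitTransversal Θ) :
    -- each listed representation is irreducible
    (∀ θ ∈ Θ, ∀ r : ℕ, r < n / LamplighterCircle.period θ →
      (LamplighterCircle.indRep θ r).IsIrreducible) ∧
    -- distinct indices give inequivalent representations
    (∀ θ ∈ Θ, ∀ r : ℕ, r < n / LamplighterCircle.period θ →
      ∀ θ' ∈ Θ, ∀ r' : ℕ, r' < n / LamplighterCircle.period θ' →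
        Nonempty ((LamplighterCircle.indRep θ r).Equiv (LamplighterCircle.indRep θ' r')) →
          θ = θ' ∧ r = r') ∧
    -- every irreducible complex representation is equivalent to a listed one
    (∀ (V : Type*) [AddCommGroup V] [Module ℂ V]
      (ρ : Representation ℂ (LamplighterCircle.Wreath n) V), ρ.IsIrreducible →
        ∃ θ ∈ Θ, ∃ r : ℕ, r < n / LamplighterCircle.period θ ∧
          Nonempty (ρ.Equiv (LamplighterCircle.indRep θ r))) := by
  refine ⟨fun θ hθ r hr => LamplighterCircle.isIrreducible_indRep hΘ hθ hr, ?_, ?_⟩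
  · rintro θ hθ r hr θ' hθ' r' hr' ⟨e⟩
    -- The equivalence carries the generator to a nonzero weight vector of index (θ, r) in the
    -- second representation.
    obtain ⟨h1, h2, -⟩ := (LamplighterCircle.isWeightVector_indGen.map
      e.toIntertwiningMap).eq_of_indRep hΘ hθ' hr' hθ hr
        ((map_ne_zero_iff e e.injective).2 LamplighterCircle.indGen_ne_zero)
    exact ⟨h1.symm, h2.symm⟩
  · intro V _ _ ρ hρ
    have : Nontrivial V := by
      by_contra h
      rw [not_nontrivial_iff_subsingleton] at h
      exact bot_ne_top (α := Subrepresentation ρ)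
        (Subrepresentation.toSubmodule_injective (Subsingleton.elim _ _))
    obtain ⟨θ, hθ, r, hr, v, hv0, hv⟩ := LamplighterCircle.exists_isWeightVector ρ hΘ
    obtain ⟨f, hf⟩ := LamplighterCircle.exists_intertwiningMap_of_isWeightVector hv
    have := LamplighterCircle.isIrreducible_indRep hΘ hθ hr
    refine ⟨θ, hθ, r, hr, ⟨(f.ofBijective ?_).symm⟩⟩
    -- Schur's lemma: f is nonzero because it maps the generator to v.
    refine (Representation.IsIrreducible.bijective_or_eq_zero f).resolve_right fun h0 => hv0 ?_
    rw [← hf, h0]; rfl
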